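/- Let $X_1,X_2,\dots$ be identically distributed real-valued random variables on a probability space $(\Omega,\mathcal F,\mathbf P)$ (stationarity is not assumed), with common distribution function $F(x)=\mathbf P(X_1\le x)$. For $n\ge1$ let $$\varphi(n)=\sup_{k\ge1}\,\sup\bigl\{|\mathbf P(B\mid A)-\mathbf P(B)| : A\in\mathcal F_1^k,\ B\in\mathcal F_{k+n}^\infty,\ \mathbf P(A)>0\bigr\},$$ where $\mathcal F_1^k$ and $\mathcal F_{k+n}^\infty$ are the $\sigma$-fields generated by $\{X_i: 1\le i\le k\}$ and $\{X_i: i\ge k+n\}$ respectively. Suppose that the sequence is $\varphi$-mixing, i.e. $\varphi(n)\to0$ as $n\to\infty$, and that $$\sum_{n\ge1}\varphi^{1/2}(2^n)<\infty.$$ Then: (a) for every Borel measurable function $f:\mathbb R\to\mathbb R$ with $\mathbf E|f(X_1)|<\infty$, $$\frac1n\sum_{i=1}^n f(X_i)\to\mathbf E f(X_1)\quad\text{almost surely as } n\to\infty;$$ (b) $$\sup_{-\infty<x<\infty}|F_n(x)-F(x)|\to0\quad\text{almost surely as } n\to\infty,$$ where $F_n(x)=\frac1n\#\{1\le i\le n: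 X_i\le x\}$ is the empirical distribution function of $X_1,\dots,X_n$. -/

import Mathlib

open MeasureTheory ProbabilityTheory Filter Topology

noncomputable section

/-- The `σ`-field `𝓕₁ᵏ` generated by `X₁, …, X_k`. -/
@[reducible] def pastSigma {Ω : Type*} (X : ℕ → Ω → ℝ) (k : ℕ) : MeasurableSpace Ω :=
  ⨆ i ∈ Set.Icc 1 k, MeasurableSpace.comap (X i) inferInstance

/-- The `σ`-field `𝓕ₘ^∞` generated by `Xᵢ`, `i ≥ m`. -/
@[reducible] def futureSigma {Ω : Type*} (X : ℕ → Ω → ℝ) (m : ℕ) : MeasurableSpace Ω :=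
  ⨆ i ∈ Set.Ici m, MeasurableSpace.comap (X i) inferInstance

/-- The uniform mixing coefficient: the supremum of `|P(B | A) - P(B)|` over all `k ≥ 1`,
`A ∈ 𝓕₁ᵏ` with `P(A) > 0`, and `B ∈ 𝓕_{k+n}^∞`. For a probability measure the set of these
numbers is a nonempty subset of `[0, 1]`. -/
def phiMix {Ω : Type*} [MeasurableSpace Ω] (μ : Measure Ω) (X : ℕ → Ω → ℝ) (n : ℕ) : ℝ :=
  sSup {r : ℝ | ∃ k : ℕ, 1 ≤ k ∧ ∃ A B : Set Ω,
    MeasurableSet[pastSigma X k] A ∧ MeasurableSet[futureSigma X (k + n)] B ∧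
      0 < μ A ∧ r = |(μ[|A]).real B - μ.real B|}

/-- The sequence `X₁, X₂, …` is `φ`-mixing (the value of `X` at index `0` plays no role). -/
def IsPhiMixing {Ω : Type*} [MeasurableSpace Ω] (μ : Measure Ω) (X : ℕ → Ω → ℝ) : Prop :=
  Tendsto (phiMix μ X) atTop (𝓝 0)

/-- The empirical distribution function `Fₙ(x) = n⁻¹ #{1 ≤ i ≤ n : Xᵢ ≤ x}`. -/
def empiricalCDF {Ω : Type*} (X : ℕ → Ω → ℝ) (n : ℕ) (ω : Ω) (x : ℝ) : ℝ :=
  ((Finset.Icc 1 n).filter (fun i => X i ω ≤ x)).card / (n : ℝ)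

end

/-! Mixing enters only through second moments. For ξ, η measurable with respect to σ-fields with
mixing bound φ, the covariance is at most 2√φ‖ξ‖₂‖η‖₂ (`sq_covariance_le`). Opening a gap g between
two adjacent blocks of centred terms therefore shows that doubling the block length multiplies the
L² norm by at most √2(1 + √φ(g)), up to an error linear in g. With g about the fourth root of the
block length, summability of φ^{1/2}(2ⁿ) bounds the product of the extra factors, and variances grow
linearly with a constant independent of the functions summed (`exists_variance_sum_le`).

This uniformity matters because the truncation levels grow. The linear bound replaces independence
in Etemadi's proof of the strong law: truncate, use Chebyshev and Borel–Cantelli along ⌊cⁿ⌋, then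
interpolate by monotonicity (`ae_tendsto_sum_div_of_variance_le`). Positive and negative parts give
(a). For (b), (a) is applied to indicators of half-lines ending at countably many quantiles, and
monotonicity makes the convergence uniform (`tendsto_iSup_abs_sub_cdf`). -/

/-! ### Covariance inequality under uniform mixing -/

section Covariance

variable {Ω : Type*} {m m₁ m₂ m0 : MeasurableSpace Ω} {μ : Measure Ω}

lemma integral_comp_mul_eq_sum (hm : m ≤ m0) {ξ : Ω → ℝ} (hξ : Measurable[m] ξ) {s : Finset ℝ}
    (hξs : ∀ ω, ξ ω ∈ s) (g : ℝ → ℝ)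
    {h : Ω → ℝ} (hh : Integrable h μ) :
    ∫ ω, g (ξ ω) * h ω ∂μ = ∑ a ∈ s, g a * ∫ ω in ξ ⁻¹' {a}, h ω ∂μ := by
  have hs : ∀ a, MeasurableSet (ξ ⁻¹' {a}) := fun a => hm _ (hξ (measurableSet_singleton a))
  have hpt : ∀ ω, g (ξ ω) * h ω = ∑ a ∈ s, g a * (ξ ⁻¹' {a}).indicator h ω := by
    intro ω
    rw [Finset.sum_eq_single (ξ ω)]
    · simp
    · intro b _ hb
      rw [Set.indicator_of_notMem (by simpa using hb.symm), mul_zero]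
    · intro hn
      exact absurd (hξs ω) hn
  simp_rw [hpt]
  rw [integral_finsetSum _ fun a _ => (hh.indicator (hs a)).const_mul _]
  exact Finset.sum_congr rfl fun a _ => by rw [integral_const_mul, integral_indicator (hs a)]

/-- The total discrepancy over a finite disjoint family of events is at most twice the
discrepancy of a single event. -/
lemma sum_abs_measureReal_inter_sub_le [IsProbabilityMeasure μ] (hm₂ : m₂ ≤ m0) {φ : ℝ}
    {A : Set Ω}
    (hφ : ∀ B, MeasurableSet[m₂] B → |μ.real (A ∩ B) - μ.real A * μ.real B| ≤ φ * μ.real A)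
    {η : Ω → ℝ} (hη : Measurable[m₂] η) (s : Finset ℝ) :
    ∑ b ∈ s, |μ.real (A ∩ η ⁻¹' {b}) - μ.real A * μ.real (η ⁻¹' {b})| ≤ 2 * φ * μ.real A := by
  classical
  set d : ℝ → ℝ := fun b => μ.real (A ∩ η ⁻¹' {b}) - μ.real A * μ.real (η ⁻¹' {b}) with hd
  have hsum : ∀ t : Finset ℝ, ∑ b ∈ t, d b =
      μ.real (A ∩ η ⁻¹' (t : Set ℝ)) - μ.real A * μ.real (η ⁻¹' (t : Set ℝ)) := by
    intro t
    have hU : η ⁻¹' (t : Set ℝ) = ⋃ b ∈ t, η ⁻¹' {b} := by ext ω; simp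
    have hdisj : Set.PairwiseDisjoint (t : Set ℝ) fun b => η ⁻¹' {b} := by
      intro b _ b' _ hbb
      exact Disjoint.preimage _ (by simpa using hbb)
    have hs : ∀ a, MeasurableSet (η ⁻¹' {a}) := fun a => hm₂ _ (hη (measurableSet_singleton a))
    have h1 : μ.real (η ⁻¹' (t : Set ℝ)) = ∑ b ∈ t, μ.real (η ⁻¹' {b}) := by
      rw [hU, measureReal_biUnion_finset hdisj fun b _ => hs b]
    have h2 : μ.real (A ∩ η ⁻¹' (t : Set ℝ)) = ∑ b ∈ t, μ.real (A ∩ η ⁻¹' {b}) := by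
      have := measureReal_biUnion_finset (μ := μ.restrict A) hdisj fun b _ => hs b
      rw [← hU, measureReal_restrict_apply (hm₂ _ (hη t.measurableSet))] at this
      rw [Set.inter_comm, this]
      exact Finset.sum_congr rfl fun b _ => by
        rw [measureReal_restrict_apply (hs b), Set.inter_comm]
    rw [h1, h2, Finset.mul_sum, ← Finset.sum_sub_distrib]
  have hbd : ∀ t : Finset ℝ, |∑ b ∈ t, d b| ≤ φ * μ.real A := fun t => by
    rw [hsum]; exact hφ _ (hη t.measurableSet)
  -- Split by the sign of `d`: each half is, up to sign, the discrepancy of one event, whence the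
  -- factor 2.
  rw [← Finset.sum_filter_add_sum_filter_not s (fun b => 0 ≤ d b)]
  have h1 : ∑ b ∈ s with 0 ≤ d b, |d b| = ∑ b ∈ s with 0 ≤ d b, d b :=
    Finset.sum_congr rfl fun b hb => abs_of_nonneg (Finset.mem_filter.1 hb).2
  have h2 : ∑ b ∈ s with ¬ 0 ≤ d b, |d b| = -∑ b ∈ s with ¬ 0 ≤ d b, d b := by
    rw [← Finset.sum_neg_distrib]
    exact Finset.sum_congr rfl fun b hb =>
      abs_of_neg (not_le.1 (Finset.mem_filter.1 hb).2)
  have h3 := (abs_le.1 (hbd {b ∈ s | 0 ≤ d b})).2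
  have h4 := (abs_le.1 (hbd {b ∈ s | ¬ 0 ≤ d b})).1
  linarith

lemma integrable_comp_of_forall_mem_finset [IsFiniteMeasure μ] (hm : m ≤ m0) {η : Ω → ℝ}
    (hη : Measurable[m] η) {t : Finset ℝ} (hηt : ∀ ω, η ω ∈ t) {g : ℝ → ℝ} (hg : Measurable g) :
    Integrable (fun ω => g (η ω)) μ :=
  .of_bound (hg.comp (hη.mono hm le_rfl)).aestronglyMeasurable (∑ b ∈ t, ‖g b‖)
    (.of_forall fun ω => Finset.single_le_sum (f := fun b => ‖g b‖) (fun _ _ => norm_nonneg _)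
      (hηt ω))

/-- The difference is Σ b·d(b), with d(b) the discrepancy of {η = b}. Cauchy–Schwarz with weights
|d(b)| leaves their total mass, at most 2φP(A), times a second moment in which |d(b)| is bounded by
the sum of its two terms. -/
lemma sq_setIntegral_sub_le [IsProbabilityMeasure μ] (hm₂ : m₂ ≤ m0) {φ : ℝ}
    {A : Set Ω}
    (hφ : ∀ B, MeasurableSet[m₂] B → |μ.real (A ∩ B) - μ.real A * μ.real B| ≤ φ * μ.real A)
    {η : Ω → ℝ} (hη : Measurable[m₂] η) {t : Finset ℝ} (hηt : ∀ ω, η ω ∈ t) :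
    (∫ ω in A, η ω ∂μ - μ.real A * ∫ ω, η ω ∂μ) ^ 2 ≤
      2 * φ * μ.real A * (∫ ω in A, η ω ^ 2 ∂μ + μ.real A * ∫ ω, η ω ^ 2 ∂μ) := by
  have hs : ∀ a, MeasurableSet (η ⁻¹' {a}) := fun a => hm₂ _ (hη (measurableSet_singleton a))
  have hI : ∀ (ν : Measure Ω) [IsFiniteMeasure ν] (g : ℝ → ℝ),
      ∫ ω, g (η ω) ∂ν = ∑ b ∈ t, g b * ν.real (η ⁻¹' {b}) := by
    intro ν _ g
    simpa using integral_comp_mul_eq_sum hm₂ hη hηt g (integrable_const (1 : ℝ)) (μ := ν)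
  have hR : ∀ b, (μ.restrict A).real (η ⁻¹' {b}) = μ.real (A ∩ η ⁻¹' {b}) := fun b => by
    rw [measureReal_restrict_apply (hs b), Set.inter_comm]
  have e1 := hI μ id
  have e2 := hI μ (· ^ 2)
  have e3 := hI (μ.restrict A) id
  have e4 := hI (μ.restrict A) (· ^ 2)
  simp only [id, hR] at e1 e2 e3 e4
  rw [e1, e2, e3, e4]
  set d : ℝ → ℝ := fun b => μ.real (A ∩ η ⁻¹' {b}) - μ.real A * μ.real (η ⁻¹' {b}) with hd
  have hL : ∑ b ∈ t, b * μ.real (A ∩ η ⁻¹' {b}) -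
      μ.real A * ∑ b ∈ t, b * μ.real (η ⁻¹' {b}) = ∑ b ∈ t, b * d b := by
    rw [Finset.mul_sum, ← Finset.sum_sub_distrib]
    exact Finset.sum_congr rfl fun b _ => by simp only [hd]; ring
  rw [hL]
  have hCS := Finset.sum_sq_le_sum_mul_sum_of_sq_le_mul t
    (r := fun b => b * d b) (f := fun b => |d b|) (g := fun b => b ^ 2 * |d b|)
    (fun b _ => abs_nonneg _) (fun b _ => by positivity)
    (fun b _ => by rw [mul_pow, ← sq_abs (d b)]; exact le_of_eq (by ring))
  have hsum := sum_abs_measureReal_inter_sub_le hm₂ hφ hη t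
  refine hCS.trans (mul_le_mul hsum ?_ (Finset.sum_nonneg fun b _ => by positivity)
    ((Finset.sum_nonneg fun b _ => abs_nonneg _).trans hsum))
  rw [Finset.mul_sum, ← Finset.sum_add_distrib]
  refine Finset.sum_le_sum fun b _ => ?_
  have : |d b| ≤ μ.real (A ∩ η ⁻¹' {b}) + μ.real A * μ.real (η ⁻¹' {b}) := by
    have h1 : 0 ≤ μ.real (A ∩ η ⁻¹' {b}) := measureReal_nonneg
    have h2 : 0 ≤ μ.real A * μ.real (η ⁻¹' {b}) := by positivity
    rw [abs_le]; constructor <;> simp only [hd] <;> linarith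
  nlinarith [mul_le_mul_of_nonneg_left this (sq_nonneg b)]

/-- Decompose over the events {ξ = a}, apply `sq_setIntegral_sub_le` to each, and recombine by a
second Cauchy–Schwarz over a. -/
lemma sq_covariance_le_of_forall_mem_finset [IsProbabilityMeasure μ] (hm₁ : m₁ ≤ m0) (hm₂ : m₂ ≤ m0)
    {φ : ℝ} (hφ0 : 0 ≤ φ)
    (hφ : ∀ A, MeasurableSet[m₁] A → ∀ B, MeasurableSet[m₂] B →
      |μ.real (A ∩ B) - μ.real A * μ.real B| ≤ φ * μ.real A)
    {ξ η : Ω → ℝ} (hξ : Measurable[m₁] ξ) (hη : Measurable[m₂] η) {s t : Finset ℝ}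
    (hξs : ∀ ω, ξ ω ∈ s) (hηt : ∀ ω, η ω ∈ t) :
    (∫ ω, ξ ω * η ω ∂μ - (∫ ω, ξ ω ∂μ) * ∫ ω, η ω ∂μ) ^ 2 ≤
      4 * φ * (∫ ω, ξ ω ^ 2 ∂μ) * ∫ ω, η ω ^ 2 ∂μ := by
  have hη1 : Integrable η μ :=
    integrable_comp_of_forall_mem_finset hm₂ hη hηt measurable_id
  have hη2 : Integrable (fun ω => η ω ^ 2) μ :=
    integrable_comp_of_forall_mem_finset hm₂ hη hηt (measurable_id.pow_const 2)
  have e1 := integral_comp_mul_eq_sum hm₁ hξ hξs id hη1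
  have e2 := integral_comp_mul_eq_sum hm₁ hξ hξs id (integrable_const (1 : ℝ)) (μ := μ)
  have e3 := integral_comp_mul_eq_sum hm₁ hξ hξs (· ^ 2) (integrable_const (1 : ℝ)) (μ := μ)
  have e4 := integral_comp_mul_eq_sum hm₁ hξ hξs (fun _ => 1) hη2
  have e5 := integral_comp_mul_eq_sum hm₁ hξ hξs (fun _ => 1) (integrable_const (1 : ℝ)) (μ := μ)
  simp only [id, mul_one, one_mul, smul_eq_mul, integral_const, probReal_univ, measureReal_restrict_apply_univ]
    at e1 e2 e3 e4 e5
  have hL : ∫ ω, ξ ω * η ω ∂μ - (∫ ω, ξ ω ∂μ) * ∫ ω, η ω ∂μ =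
      ∑ a ∈ s, a * (∫ ω in ξ ⁻¹' {a}, η ω ∂μ - μ.real (ξ ⁻¹' {a}) * ∫ ω, η ω ∂μ) := by
    rw [e1, e2, Finset.sum_mul, ← Finset.sum_sub_distrib]
    exact Finset.sum_congr rfl fun a _ => by ring
  have hR : 2 * φ * ∑ a ∈ s, (∫ ω in ξ ⁻¹' {a}, η ω ^ 2 ∂μ +
      μ.real (ξ ⁻¹' {a}) * ∫ ω, η ω ^ 2 ∂μ) = 4 * φ * ∫ ω, η ω ^ 2 ∂μ := by
    rw [Finset.sum_add_distrib, ← e4, ← Finset.sum_mul, ← e5]; ring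
  have hint : ∀ s : Set Ω, 0 ≤ ∫ ω in s, η ω ^ 2 ∂μ := fun s =>
    integral_nonneg fun ω => sq_nonneg _
  have hint' : 0 ≤ ∫ ω, η ω ^ 2 ∂μ := integral_nonneg fun ω => sq_nonneg _
  rw [hL]
  refine (Finset.sum_sq_le_sum_mul_sum_of_sq_le_mul s
    (f := fun a => a ^ 2 * μ.real (ξ ⁻¹' {a}))
    (g := fun a => 2 * φ * (∫ ω in ξ ⁻¹' {a}, η ω ^ 2 ∂μ +
      μ.real (ξ ⁻¹' {a}) * ∫ ω, η ω ^ 2 ∂μ))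
    (fun a _ => by positivity)
    (fun a _ => mul_nonneg (by positivity)
      (add_nonneg (hint _) (mul_nonneg measureReal_nonneg hint')))
    (fun a _ => ?_)).trans_eq ?_
  · have := sq_setIntegral_sub_le hm₂ (hφ _ (hξ (measurableSet_singleton a))) hη hηt
    rw [mul_pow]
    nlinarith [mul_le_mul_of_nonneg_left this (sq_nonneg a)]
  · rw [← Finset.mul_sum, hR, e3]; ring

/-- **Covariance inequality** for uniform mixing of two `σ`-algebras. -/
lemma sq_covariance_le [IsProbabilityMeasure μ] (hm₁ : m₁ ≤ m0) (hm₂ : m₂ ≤ m0)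
    {φ : ℝ} (hφ0 : 0 ≤ φ)
    (hφ : ∀ A, MeasurableSet[m₁] A → ∀ B, MeasurableSet[m₂] B →
      |μ.real (A ∩ B) - μ.real A * μ.real B| ≤ φ * μ.real A)
    {ξ η : Ω → ℝ} (hξ : Measurable[m₁] ξ) (hη : Measurable[m₂] η) {c : ℝ}
    (hξc : ∀ ω, |ξ ω| ≤ c) (hηc : ∀ ω, |η ω| ≤ c) :
    (∫ ω, ξ ω * η ω ∂μ - (∫ ω, ξ ω ∂μ) * ∫ ω, η ω ∂μ) ^ 2 ≤
      4 * φ * (∫ ω, ξ ω ^ 2 ∂μ) * ∫ ω, η ω ^ 2 ∂μ := by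
  obtain ⟨ω₀⟩ : Nonempty Ω := nonempty_of_isProbabilityMeasure μ
  have hc : 0 ≤ c := (abs_nonneg _).trans (hξc ω₀)
  have sξ : StronglyMeasurable[m₁] ξ := hξ.stronglyMeasurable
  have sη : StronglyMeasurable[m₂] η := hη.stronglyMeasurable
  -- The approximants must be simple for `m₁` and `m₂` themselves, to keep the mixing bound, and
  -- bounded by `c`, for dominated convergence.
  let x : ℕ → Ω → ℝ := fun n => sξ.approxBounded c n
  let y : ℕ → Ω → ℝ := fun n => sη.approxBounded c n
  have hxm : ∀ n, Measurable[m₁] (x n) := fun n => 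
    @SimpleFunc.measurable Ω ℝ m₁ _ (sξ.approxBounded c n)
  have hym : ∀ n, Measurable[m₂] (y n) := fun n => 
    @SimpleFunc.measurable Ω ℝ m₂ _ (sη.approxBounded c n)
  have hxs : ∀ n ω, x n ω ∈ @SimpleFunc.range Ω ℝ m₁ (sξ.approxBounded c n) := fun n ω =>
    @SimpleFunc.mem_range_self Ω ℝ m₁ (sξ.approxBounded c n) ω
  have hyt : ∀ n ω, y n ω ∈ @SimpleFunc.range Ω ℝ m₂ (sη.approxBounded c n) := fun n ω =>
    @SimpleFunc.mem_range_self Ω ℝ m₂ (sη.approxBounded c n) ω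
  have hx : ∀ ω, Tendsto (fun n => x n ω) atTop (𝓝 (ξ ω)) := fun ω =>
    sξ.tendsto_approxBounded_of_norm_le (hξc ω)
  have hy : ∀ ω, Tendsto (fun n => y n ω) atTop (𝓝 (η ω)) := fun ω =>
    sη.tendsto_approxBounded_of_norm_le (hηc ω)
  have hxc : ∀ n ω, ‖x n ω‖ ≤ c := sξ.norm_approxBounded_le hc
  have hyc : ∀ n ω, ‖y n ω‖ ≤ c := sη.norm_approxBounded_le hc
  have xm : ∀ n, Measurable (x n) := fun n => (hxm n).mono hm₁ le_rfl
  have ym : ∀ n, Measurable (y n) := fun n => (hym n).mono hm₂ le_rfl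
  have key : ∀ (u : ℕ → Ω → ℝ) (v : Ω → ℝ) (C : ℝ), (∀ n, Measurable (u n)) →
      (∀ n ω, ‖u n ω‖ ≤ C) → (∀ ω, Tendsto (fun n => u n ω) atTop (𝓝 (v ω))) →
      Tendsto (fun n => ∫ ω, u n ω ∂μ) atTop (𝓝 (∫ ω, v ω ∂μ)) := fun u v C hu hC hl =>
    tendsto_integral_of_dominated_convergence (fun _ => C) (fun n => (hu n).aestronglyMeasurable)
      (integrable_const C) (fun n => .of_forall (hC n)) (.of_forall hl)
  have t1 := key (fun n ω => x n ω * y n ω) (fun ω => ξ ω * η ω) (c * c)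
    (fun n => (xm n).mul (ym n))
    (fun n ω => by rw [norm_mul]; exact mul_le_mul (hxc n ω) (hyc n ω) (norm_nonneg _) hc)
    (fun ω => (hx ω).mul (hy ω))
  have t2 := key (fun n ω => x n ω) ξ c xm hxc hx
  have t3 := key (fun n ω => y n ω) η c ym hyc hy
  have t4 := key (fun n ω => x n ω ^ 2) (fun ω => ξ ω ^ 2) (c ^ 2)
    (fun n => (xm n).pow_const 2)
    (fun n ω => by rw [norm_pow]; exact pow_le_pow_left₀ (norm_nonneg _) (hxc n ω) 2)
    (fun ω => (hx ω).pow 2)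
  have t5 := key (fun n ω => y n ω ^ 2) (fun ω => η ω ^ 2) (c ^ 2)
    (fun n => (ym n).pow_const 2)
    (fun n ω => by rw [norm_pow]; exact pow_le_pow_left₀ (norm_nonneg _) (hyc n ω) 2)
    (fun ω => (hy ω).pow 2)
  exact le_of_tendsto_of_tendsto' ((t1.sub (t2.mul t3)).pow 2) ((t4.const_mul _).mul t5)
    fun n => sq_covariance_le_of_forall_mem_finset hm₁ hm₂ hφ0 hφ (hxm n) (hym n)
      (hxs n) (hyt n)

end Covariance

/-! ### From the mixing coefficient to events -/

section MixingCoefficient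

variable {Ω : Type*} {m0 : MeasurableSpace Ω} {μ : Measure Ω} {X : ℕ → Ω → ℝ}

lemma phiMix_nonneg (n : ℕ) : 0 ≤ phiMix μ X n := by
  refine Real.sSup_nonneg ?_
  rintro r ⟨k, -, A, B, -, -, -, rfl⟩
  exact abs_nonneg _

lemma pastSigma_le (hX : ∀ i, 1 ≤ i → Measurable (X i)) (k : ℕ) : pastSigma X k ≤ m0 :=
  iSup₂_le fun i hi => (hX i hi.1).comap_le

lemma futureSigma_le (hX : ∀ i, 1 ≤ i → Measurable (X i)) {k : ℕ} (hk : 1 ≤ k) :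
    futureSigma X k ≤ m0 :=
  iSup₂_le fun i hi => (hX i (hk.trans hi)).comap_le

lemma measurable_pastSigma {i k : ℕ} (hi : 1 ≤ i) (hik : i ≤ k) :
    Measurable[pastSigma X k] (X i) := by
  rw [measurable_iff_comap_le]
  exact le_iSup₂_of_le (f := fun i (_ : i ∈ Set.Icc 1 k) =>
    MeasurableSpace.comap (X i) inferInstance) i ⟨hi, hik⟩ le_rfl

lemma measurable_futureSigma {i k : ℕ} (hik : k ≤ i) : Measurable[futureSigma X k] (X i) := by
  rw [measurable_iff_comap_le]
  exact le_iSup₂_of_le (f := fun i (_ : i ∈ Set.Ici k) =>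
    MeasurableSpace.comap (X i) inferInstance) i hik le_rfl

/-- Multiplying the conditional bound by P(A) gives a form that also covers null A, as needed when A
runs over all level sets of a function. -/
lemma abs_measureReal_inter_sub_le_phiMix [IsProbabilityMeasure μ]
    (hX : ∀ i, 1 ≤ i → Measurable (X i)) {k n : ℕ} (hk : 1 ≤ k) {A B : Set Ω}
    (hA : MeasurableSet[pastSigma X k] A) (hB : MeasurableSet[futureSigma X (k + n)] B) :
    |μ.real (A ∩ B) - μ.real A * μ.real B| ≤ phiMix μ X n * μ.real A := by
  rcases eq_or_ne (μ A) 0 with h0 | h0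
  · have h1 : μ.real A = 0 := by simp [measureReal_def, h0]
    have h2 : μ.real (A ∩ B) = 0 :=
      le_antisymm ((measureReal_mono Set.inter_subset_left).trans_eq h1) measureReal_nonneg
    simp [h1, h2]
  have hpos : 0 < μ.real A := ENNReal.toReal_pos h0 (measure_ne_top _ _)
  have hle : |(μ[|A]).real B - μ.real B| ≤ phiMix μ X n := by
    refine le_csSup ⟨1, ?_⟩ ⟨k, hk, A, B, hA, hB, pos_iff_ne_zero.2 h0, rfl⟩
    rintro r ⟨k, -, A, B, -, -, hA0, rfl⟩
    have : IsProbabilityMeasure (μ[|A]) := cond_isProbabilityMeasure hA0.ne'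
    have h1 : (μ[|A]).real B ≤ 1 := measureReal_le_one
    have h2 : μ.real B ≤ 1 := measureReal_le_one
    rw [abs_le]
    constructor <;> linarith [measureReal_nonneg (μ := μ[|A]) (s := B),
      measureReal_nonneg (μ := μ) (s := B)]
  have heq : μ.real (A ∩ B) - μ.real A * μ.real B =
      ((μ[|A]).real B - μ.real B) * μ.real A := by
    rw [measureReal_def (μ[|A]), cond_apply (pastSigma_le hX k _ hA), ENNReal.toReal_mul,
      ENNReal.toReal_inv, ← measureReal_def, ← measureReal_def]
    field_simp
  rw [heq, abs_mul, abs_of_pos hpos]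
  gcongr

end MixingCoefficient

/-! ### Linear growth of variances -/

section VarianceGrowth

variable {Ω : Type*} {m0 : MeasurableSpace Ω} {μ : Measure Ω}

lemma sq_lpNorm_two {f : Ω → ℝ} (hf : AEStronglyMeasurable f μ) :
    lpNorm f 2 μ ^ 2 = ∫ ω, f ω ^ 2 ∂μ := by
  rw [lpNorm_eq_integral_norm_rpow_toReal two_ne_zero ENNReal.ofNat_ne_top hf]
  have h : 0 ≤ ∫ ω, f ω ^ 2 ∂μ := integral_nonneg fun ω => sq_nonneg _
  simp only [ENNReal.toReal_ofNat, Real.rpow_ofNat, Real.norm_eq_abs, sq_abs]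
  rw [← one_div, ← Real.sqrt_eq_rpow, Real.sq_sqrt h]

/-- Expanding the square gives at most 2u²(1 + 2√φ) ≤ 2u²(1 + √φ)². -/
lemma lpNorm_add_le_of_sq_integral_mul_le [IsProbabilityMeasure μ] {ξ η : Ω → ℝ}
    (hξ : MemLp ξ 2 μ) (hη : MemLp η 2 μ) {φ u : ℝ} (hφ0 : 0 ≤ φ)
    (hξu : lpNorm ξ 2 μ ≤ u) (hηu : lpNorm η 2 μ ≤ u)
    (h : (∫ ω, ξ ω * η ω ∂μ) ^ 2 ≤ 4 * φ * (∫ ω, ξ ω ^ 2 ∂μ) * ∫ ω, η ω ^ 2 ∂μ) :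
    lpNorm (ξ + η) 2 μ ≤ √2 * u * (1 + √φ) := by
  have hu : 0 ≤ u := lpNorm_nonneg.trans hξu
  have hs : 0 ≤ √φ := Real.sqrt_nonneg _
  have hss : √φ ^ 2 = φ := Real.sq_sqrt hφ0
  have h2 : √2 ^ 2 = (2 : ℝ) := Real.sq_sqrt zero_le_two
  have hξ2 : ∫ ω, ξ ω ^ 2 ∂μ ≤ u ^ 2 := by
    rw [← sq_lpNorm_two hξ.1]
    exact pow_le_pow_left₀ lpNorm_nonneg hξu 2
  have hη2 : ∫ ω, η ω ^ 2 ∂μ ≤ u ^ 2 := by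
    rw [← sq_lpNorm_two hη.1]
    exact pow_le_pow_left₀ lpNorm_nonneg hηu 2
  have hη0 : 0 ≤ ∫ ω, η ω ^ 2 ∂μ := integral_nonneg fun ω => sq_nonneg _
  have hmul : ∫ ω, ξ ω * η ω ∂μ ≤ 2 * √φ * u ^ 2 := by
    refine le_of_abs_le (abs_le_of_sq_le_sq (h.trans ?_) (by positivity))
    calc 4 * φ * (∫ ω, ξ ω ^ 2 ∂μ) * ∫ ω, η ω ^ 2 ∂μ ≤ 4 * φ * u ^ 2 * u ^ 2 := by gcongr
      _ = (2 * √φ * u ^ 2) ^ 2 := by rw [mul_pow, mul_pow, hss]; ring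
  have hexp : ∫ ω, (ξ + η) ω ^ 2 ∂μ =
      ∫ ω, ξ ω ^ 2 ∂μ + 2 * ∫ ω, ξ ω * η ω ∂μ + ∫ ω, η ω ^ 2 ∂μ := by
    rw [← integral_const_mul, ← integral_add, ← integral_add]
    · exact integral_congr_ae (.of_forall fun ω => by simp only [Pi.add_apply]; ring)
    · exact hξ.integrable_sq.add ((hξ.integrable_mul hη).const_mul 2)
    · exact hη.integrable_sq
    · exact hξ.integrable_sq
    · exact (hξ.integrable_mul hη).const_mul 2
  refine le_of_abs_le (abs_le_of_sq_le_sq ?_ (by positivity))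
  rw [sq_lpNorm_two (hξ.add hη).1, hexp, mul_pow, mul_pow, h2]
  nlinarith [mul_nonneg (sq_nonneg u) (sq_nonneg (√φ))]

/-- The block of `n` consecutive terms after the first `a`. -/
def blockSum (Z : ℕ → Ω → ℝ) (a n : ℕ) : Ω → ℝ := ∑ i ∈ Finset.range n, Z (a + i)

lemma blockSum_add (Z : ℕ → Ω → ℝ) (a m n : ℕ) :
    blockSum Z a (m + n) = blockSum Z a m + blockSum Z (a + m) n := by
  simp only [blockSum, Finset.sum_range_add, add_assoc]

lemma measurable_blockSum {Z : ℕ → Ω → ℝ} {a n : ℕ} (hZ : ∀ i < n, Measurable (Z (a + i))) :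
    Measurable (blockSum Z a n) := by
  have h : blockSum Z a n = fun ω => ∑ i ∈ Finset.range n, Z (a + i) ω := by
    ext ω; simp [blockSum]
  rw [h]
  exact Finset.measurable_sum _ fun i hi => hZ i (Finset.mem_range.1 hi)

lemma memLp_blockSum {Z : ℕ → Ω → ℝ} (hZ : ∀ i, MemLp (Z i) 2 μ) (a n : ℕ) :
    MemLp (blockSum Z a n) 2 μ :=
  memLp_finsetSum' _ fun _ _ => hZ _

lemma lpNorm_blockSum_le {Z : ℕ → Ω → ℝ} (hZ : ∀ i, MemLp (Z i) 2 μ) {M : ℝ}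
    (hM : ∀ i, lpNorm (Z i) 2 μ ≤ M) (a n : ℕ) : lpNorm (blockSum Z a n) 2 μ ≤ n * M := by
  refine (lpNorm_sum_le (fun i _ => hZ _) one_le_two).trans ?_
  simpa using Finset.sum_le_card_nsmul (Finset.range n) _ M fun i _ => hM (a + i)

/-- Each term of `q` is merely repeated d times. -/
lemma summable_comp_div {q : ℕ → ℝ} (hq0 : ∀ n, 0 ≤ q n) (hq : Summable q) (d : ℕ) [NeZero d] :
    Summable fun r : ℕ => q (r / d) := by
  have h : Summable fun p : ℕ × Fin d => q p.1 * 1 :=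
    hq.mul_of_nonneg (Summable.of_finite (f := fun _ : Fin d => (1 : ℝ))) hq0
      (fun _ => zero_le_one)
  simpa [Function.comp_def, Nat.divModEquiv] using (Nat.divModEquiv d).summable_iff.2 h

variable {X : ℕ → Ω → ℝ}

/-- Doubling the block length, at the price of a gap of length `g`. -/
lemma lpNorm_blockSum_two_mul_le [IsProbabilityMeasure μ] (hX : ∀ i, 1 ≤ i → Measurable (X i))
    {h : ℕ → ℝ → ℝ} (hh : ∀ i, Measurable (h i)) {c : ℝ} (hc : ∀ i x, |h i x| ≤ c)
    (h0 : ∀ i, ∫ ω, h i (X (i + 1) ω) ∂μ = 0) {M u : ℝ}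
    (hM : ∀ i, lpNorm (fun ω => h i (X (i + 1) ω)) 2 μ ≤ M) {N : ℕ} (hN : 1 ≤ N)
    (hu : ∀ a, lpNorm (blockSum (fun i ω => h i (X (i + 1) ω)) a N) 2 μ ≤ u) (a g : ℕ) :
    lpNorm (blockSum (fun i ω => h i (X (i + 1) ω)) a (2 * N)) 2 μ ≤
      √2 * u * (1 + √(phiMix μ X g)) + 2 * g * M := by
  set Z : ℕ → Ω → ℝ := fun i ω => h i (X (i + 1) ω) with hZdef
  have hZm : ∀ i, Measurable (Z i) := fun i => (hh i).comp (hX _ (Nat.le_add_left 1 i))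
  have hZ : ∀ i, MemLp (Z i) 2 μ := fun i =>
    .of_bound (hZm i).aestronglyMeasurable c (.of_forall fun ω => hc i _)
  have hbd : ∀ b n ω, |blockSum Z b n ω| ≤ n * c := fun b n ω => by
    rw [blockSum, Finset.sum_apply]
    refine (Finset.abs_sum_le_sum_abs _ _).trans ?_
    simpa using Finset.sum_le_card_nsmul (Finset.range n) _ c fun i _ => hc (b + i) _
  -- Shift the second block right by `g`: restore the skipped terms and remove the overshoot. Each
  -- correction has `g` terms, hence 2gM.
  have hsplit : blockSum Z a (2 * N) = (blockSum Z a N + blockSum Z (a + N + g) N) +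
      (blockSum Z (a + N) g - blockSum Z (a + N + N) g) := by
    have h1 := blockSum_add Z (a + N) N g
    have h2 := blockSum_add Z (a + N) g N
    rw [add_comm N g, h2] at h1
    rw [two_mul, blockSum_add, eq_sub_of_add_eq h1.symm]
    abel
  have hcov : (∫ ω, blockSum Z a N ω * blockSum Z (a + N + g) N ω ∂μ) ^ 2 ≤
      4 * phiMix μ X g * (∫ ω, blockSum Z a N ω ^ 2 ∂μ) *
        ∫ ω, blockSum Z (a + N + g) N ω ^ 2 ∂μ := by
    have hk : 1 ≤ a + N := by omega
    have hmean : ∫ ω, blockSum Z (a + N + g) N ω ∂μ = 0 := by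
      simp only [blockSum, Finset.sum_apply]
      rw [integral_finsetSum _ fun i _ => (hZ _).integrable one_le_two]
      exact Finset.sum_eq_zero fun i _ => h0 _
    have hpast : Measurable[pastSigma X (a + N)] (blockSum Z a N) :=
      measurable_blockSum fun i hi =>
        (hh (a + i)).comp (measurable_pastSigma (by omega) (by omega))
    have hfuture : Measurable[futureSigma X (a + N + g)] (blockSum Z (a + N + g) N) :=
      measurable_blockSum fun i _ =>
        (hh (a + N + g + i)).comp (measurable_futureSigma (by omega))
    have := sq_covariance_le (μ := μ) (pastSigma_le hX (a + N))
      (futureSigma_le hX (show 1 ≤ a + N + g by omega)) (phiMix_nonneg g)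
      (fun A hA B hB => abs_measureReal_inter_sub_le_phiMix hX hk hA hB)
      hpast hfuture (hbd _ _) (hbd _ _)
    rwa [hmean, mul_zero, sub_zero] at this
  have hm := memLp_blockSum hZ
  have e1 := lpNorm_add_le_of_sq_integral_mul_le (hm a N) (hm (a + N + g) N) (phiMix_nonneg g)
    (hu _) (hu _) hcov
  have e2 := lpNorm_blockSum_le hZ hM (a + N) g
  have e3 := lpNorm_blockSum_le hZ hM (a + N + N) g
  rw [hsplit]
  have e4 := lpNorm_add_le (g := blockSum Z (a + N) g - blockSum Z (a + N + N) g)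
    ((hm a N).add (hm (a + N + g) N)) one_le_two
  have e5 := lpNorm_sub_le (g := blockSum Z (a + N + N) g) (hm (a + N) g) one_le_two
  linarith

lemma exists_lpNorm_blockSum_two_pow_le [IsProbabilityMeasure μ]
    (hX : ∀ i, 1 ≤ i → Measurable (X i))
    (hsum : Summable (fun n : ℕ => √(phiMix μ X (2 ^ (n + 1))))) :
    ∃ K : ℝ, 0 ≤ K ∧ ∀ (h : ℕ → ℝ → ℝ) (c M : ℝ), (∀ i, Measurable (h i)) →
      (∀ i x, |h i x| ≤ c) → (∀ i, ∫ ω, h i (X (i + 1) ω) ∂μ = 0) →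
      (∀ i, lpNorm (fun ω => h i (X (i + 1) ω)) 2 μ ≤ M) → ∀ r a : ℕ,
      lpNorm (blockSum (fun i ω => h i (X (i + 1) ω)) a (2 ^ r)) 2 μ ≤ K * M * √2 ^ r := by
  -- The gap is a power of two, so `hsum` applies with each term repeated four times, and it is of
  -- order 2^{r/4}, so its cost relative to √2^r decays geometrically.
  set g : ℕ → ℕ := fun r => 2 ^ (r / 4 + 1) with hg
  set p : ℕ → ℝ := fun r => √(phiMix μ X (g r)) with hp
  set e : ℕ → ℝ := fun r => 2 * g r / √2 ^ (r + 1) with he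
  have hp0 : ∀ r, 0 ≤ p r := fun r => Real.sqrt_nonneg _
  have he0 : ∀ r, 0 ≤ e r := fun r => by positivity
  have hps : Summable p := summable_comp_div (fun n => Real.sqrt_nonneg _) hsum 4
  have hs1 : (1 : ℝ) ≤ √2 := Real.one_le_sqrt.2 one_le_two
  have hs2 : √2 ^ 2 = (2 : ℝ) := Real.sq_sqrt zero_le_two
  have hes : Summable e := by
    refine .of_nonneg_of_le he0 (fun r => ?_) ((summable_comp_div (fun n => by positivity)
      (summable_geometric_of_lt_one (r := (1 / 2 : ℝ)) (by norm_num) (by norm_num)) 4).mul_left 4)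
    have h1 : √2 ^ (4 * (r / 4)) ≤ √2 ^ (r + 1) := pow_le_pow_right₀ hs1 (by omega)
    have h2 : √2 ^ (4 * (r / 4)) = (2 : ℝ) ^ (r / 4) * 2 ^ (r / 4) := by
      rw [show 4 * (r / 4) = 2 * (r / 4 + r / 4) by ring, pow_mul, hs2, pow_add]
    simp only [he, hg]
    rw [div_le_iff₀ (by positivity)]
    push_cast
    calc (2 : ℝ) * 2 ^ (r / 4 + 1) = 4 * (1 / 2) ^ (r / 4) * √2 ^ (4 * (r / 4)) := by
          rw [h2, one_div, inv_pow]; field_simp; ring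
      _ ≤ 4 * (1 / 2) ^ (r / 4) * √2 ^ (r + 1) := by gcongr
  -- The product of the factors 1 + p r is bounded by the exponential; the relative gap costs e r
  -- add up in the other factor.
  refine ⟨(1 + ∑' r, e r) * Real.exp (∑' r, p r),
    mul_nonneg (add_nonneg zero_le_one (tsum_nonneg he0)) (Real.exp_pos _).le, ?_⟩
  intro h c M hh hc h0 hM
  have hM0 : 0 ≤ M := lpNorm_nonneg.trans (hM 0)
  have key : ∀ r a : ℕ, lpNorm (blockSum (fun i ω => h i (X (i + 1) ω)) a (2 ^ r)) 2 μ ≤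
      ((1 + ∑ j ∈ Finset.range r, e j) * Real.exp (∑ j ∈ Finset.range r, p j)) * M * √2 ^ r := by
    intro r
    induction r with
    | zero => intro a; simpa [blockSum] using hM a
    | succ r ih =>
      intro a
      have := lpNorm_blockSum_two_mul_le hX hh hc h0 hM (Nat.one_le_two_pow (n := r)) ih a (g r)
      rw [pow_succ' 2 r]
      refine this.trans ?_
      set E := ∑ j ∈ Finset.range r, e j
      set P := ∑ j ∈ Finset.range r, p j
      have hE : 0 ≤ E := Finset.sum_nonneg fun j _ => he0 j
      have hP : 0 ≤ P := Finset.sum_nonneg fun j _ => hp0 j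
      rw [Finset.sum_range_succ, Finset.sum_range_succ]
      have h1 : 1 + p r ≤ Real.exp (p r) := by rw [add_comm]; exact Real.add_one_le_exp _
      have h2 : 1 ≤ Real.exp (P + p r) := Real.one_le_exp (add_nonneg hP (hp0 r))
      have h3 : 2 * (g r : ℝ) * M = e r * M * √2 ^ (r + 1) := by
        simp only [he]; field_simp
      rw [h3]
      calc √2 * ((1 + E) * Real.exp P * M * √2 ^ r) * (1 + p r) + e r * M * √2 ^ (r + 1)
          = ((1 + E) * (Real.exp P * (1 + p r)) + e r * 1) * (M * √2 ^ (r + 1)) := by ring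
        _ ≤ ((1 + E) * (Real.exp P * Real.exp (p r)) + e r * Real.exp (P + p r)) *
            (M * √2 ^ (r + 1)) := by gcongr
        _ = (1 + (E + e r)) * Real.exp (P + p r) * M * √2 ^ (r + 1) := by
            rw [← Real.exp_add]; ring
  intro r a
  refine (key r a).trans ?_
  have hT : 0 ≤ ∑' r, e r := tsum_nonneg he0
  gcongr
  · exact hes.sum_le_tsum _ fun j _ => he0 j
  · exact hps.sum_le_tsum _ fun j _ => hp0 j

/-- Peeling off the leading binary digit of n reduces to dyadic blocks, whose norms sum
geometrically. -/
lemma exists_sq_lpNorm_blockSum_le [IsProbabilityMeasure μ]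
    (hX : ∀ i, 1 ≤ i → Measurable (X i))
    (hsum : Summable (fun n : ℕ => √(phiMix μ X (2 ^ (n + 1))))) :
    ∃ K : ℝ, 0 ≤ K ∧ ∀ (h : ℕ → ℝ → ℝ) (c M : ℝ), (∀ i, Measurable (h i)) →
      (∀ i x, |h i x| ≤ c) → (∀ i, ∫ ω, h i (X (i + 1) ω) ∂μ = 0) →
      (∀ i, lpNorm (fun ω => h i (X (i + 1) ω)) 2 μ ≤ M) → ∀ n a : ℕ,
      lpNorm (blockSum (fun i ω => h i (X (i + 1) ω)) a n) 2 μ ^ 2 ≤ K * n * M ^ 2 := by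
  obtain ⟨K, hK0, hK⟩ := exists_lpNorm_blockSum_two_pow_le hX hsum
  refine ⟨(3 * K) ^ 2 * 2, by positivity, ?_⟩
  intro h c M hh hc h0 hM n a
  have hM0 : 0 ≤ M := lpNorm_nonneg.trans (hM 0)
  specialize hK h c M hh hc h0 hM
  have hs2 : √2 ^ 2 = (2 : ℝ) := Real.sq_sqrt zero_le_two
  -- Exactly what closes the induction below with constant 3: K + 3K ≤ 3K√2.
  have hs43 : (4 / 3 : ℝ) ≤ √2 := Real.le_sqrt_of_sq_le (by norm_num)
  set Z : ℕ → Ω → ℝ := fun i ω => h i (X (i + 1) ω) with hZdef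
  have hZ : ∀ i, MemLp (Z i) 2 μ := fun i =>
    .of_bound ((hh i).comp (hX _ (Nat.le_add_left 1 i))).aestronglyMeasurable c
      (.of_forall fun ω => hc i _)
  have key : ∀ r n a : ℕ, n < 2 ^ r → lpNorm (blockSum Z a n) 2 μ ≤ 3 * K * M * √2 ^ r := by
    intro r
    induction r with
    | zero =>
      intro n a hn
      obtain rfl : n = 0 := by simpa using hn
      simpa [blockSum] using by positivity
    | succ r ih =>
      intro n a hn
      rw [pow_succ']
      have hpos : 0 ≤ K * M * √2 ^ r := by positivity
      rcases lt_or_ge n (2 ^ r) with hlt | hge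
      · refine (ih n a hlt).trans ?_
        nlinarith
      · obtain ⟨n', rfl⟩ := Nat.exists_eq_add_of_le hge
        rw [blockSum_add]
        have h1 := lpNorm_add_le (g := blockSum Z (a + 2 ^ r) n')
          (memLp_blockSum hZ a (2 ^ r)) one_le_two
        have h2 := ih n' (a + 2 ^ r) (by rw [pow_succ'] at hn; omega)
        have h3 := hK r a
        nlinarith
  rcases Nat.eq_zero_or_pos n with rfl | hn
  · simp [blockSum]
  obtain ⟨r, hr⟩ : ∃ r, n.size = r + 1 := Nat.exists_eq_succ_of_ne_zero (Nat.size_pos.2 hn).ne'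
  have hlt : n < 2 ^ (r + 1) := hr ▸ Nat.lt_size_self n
  have hle : 2 ^ r ≤ n := Nat.lt_size.1 (by omega)
  have hle' : (2 : ℝ) ^ r ≤ n := by exact_mod_cast hle
  calc lpNorm (blockSum Z a n) 2 μ ^ 2 ≤ (3 * K * M * √2 ^ (r + 1)) ^ 2 := by
        exact pow_le_pow_left₀ lpNorm_nonneg (key _ _ _ hlt) 2
    _ = (3 * K) ^ 2 * 2 * 2 ^ r * M ^ 2 := by
        rw [mul_pow _ (√2 ^ (r + 1)), ← pow_mul, mul_comm (r + 1) 2, pow_mul, hs2]; ring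
    _ ≤ (3 * K) ^ 2 * 2 * n * M ^ 2 := by gcongr

/-- **Linear growth of variances** of sums of bounded functions of a `φ`-mixing sequence. -/
lemma exists_variance_sum_le [IsProbabilityMeasure μ]
    (hX : ∀ i, 1 ≤ i → Measurable (X i))
    (hsum : Summable (fun n : ℕ => √(phiMix μ X (2 ^ (n + 1))))) :
    ∃ K : ℝ, 0 ≤ K ∧ ∀ (h : ℕ → ℝ → ℝ) (n : ℕ) (c V : ℝ), (∀ i, Measurable (h i)) →
      (∀ i < n, ∀ x, |h i x| ≤ c) → 0 ≤ V → (∀ i < n, ∫ ω, h i (X (i + 1) ω) ^ 2 ∂μ ≤ V) →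
      Var[∑ i ∈ Finset.range n, fun ω => h i (X (i + 1) ω); μ] ≤ K * n * V := by
  obtain ⟨K, hK0, hK⟩ := exists_sq_lpNorm_blockSum_le hX hsum
  refine ⟨K, hK0, fun h n c V hh hc hV0 hV => ?_⟩
  set e : ℕ → ℝ := fun i => ∫ ω, h i (X (i + 1) ω) ∂μ with he
  -- Centre, and cut off at `n`, because the block estimate asks for bounds at every index.
  set h' : ℕ → ℝ → ℝ := fun i x => if i < n then h i x - e i else 0 with hh'
  have hL : ∀ i < n, MemLp (fun ω => h i (X (i + 1) ω)) 2 μ := fun i hi =>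
    .of_bound ((hh i).comp (hX _ (Nat.le_add_left 1 i))).aestronglyMeasurable c
      (.of_forall fun ω => hc i hi _)
  have hI : ∀ i < n, Integrable (fun ω => h i (X (i + 1) ω)) μ := fun i hi =>
    (hL i hi).integrable one_le_two
  have h'm : ∀ i, Measurable (h' i) := fun i => by
    by_cases hi : i < n
    · simpa [hh', hi] using (hh i).sub_const (e i)
    · simp [hh', hi]
  have h'c : ∀ i x, |h' i x| ≤ |c| + ∑ j ∈ Finset.range n, |e j| := fun i x => by
    have hs : 0 ≤ ∑ j ∈ Finset.range n, |e j| := Finset.sum_nonneg fun j _ => abs_nonneg _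
    by_cases hi : i < n
    · simp only [hh', hi, if_true]
      refine (abs_sub _ _).trans (add_le_add ((hc i hi x).trans (le_abs_self c)) ?_)
      exact Finset.single_le_sum (f := fun j => |e j|) (fun j _ => abs_nonneg _)
        (Finset.mem_range.2 hi)
    · simp only [hh', hi, if_false, abs_zero]
      positivity
  have h'0 : ∀ i, ∫ ω, h' i (X (i + 1) ω) ∂μ = 0 := fun i => by
    by_cases hi : i < n
    · simp only [hh', hi, if_true]
      rw [integral_sub (hI i hi) (integrable_const _)]
      simp [he]
    · simp [hh', hi]
  have hmeas : ∀ i, AEStronglyMeasurable (fun ω => h' i (X (i + 1) ω)) μ := fun i =>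
    ((h'm i).comp (hX _ (Nat.le_add_left 1 i))).aestronglyMeasurable
  have h'M : ∀ i, lpNorm (fun ω => h' i (X (i + 1) ω)) 2 μ ≤ √V := fun i => by
    refine Real.le_sqrt_of_sq_le ?_
    rw [sq_lpNorm_two (hmeas i)]
    by_cases hi : i < n
    · simp only [hh', hi, if_true]
      rw [← variance_eq_integral (hI i hi).aemeasurable]
      exact (variance_le_expectation_sq (hI i hi).aestronglyMeasurable).trans (hV i hi)
    · simpa [hh', hi] using hV0
  have := hK h' _ (√V) h'm h'c h'0 h'M n 0
  rw [Real.sq_sqrt hV0] at this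
  refine le_of_eq_of_le ?_ this
  rw [sq_lpNorm_two (f := blockSum _ 0 n)
      (Finset.aestronglyMeasurable_sum _ fun i _ => hmeas (0 + i)),
    variance_eq_integral (Finset.aemeasurable_sum _ fun i hi =>
      (hI i (Finset.mem_range.1 hi)).aemeasurable)]
  refine integral_congr_ae (.of_forall fun ω => ?_)
  simp only [blockSum, Finset.sum_apply, zero_add]
  rw [integral_finsetSum _ fun i hi => hI i (Finset.mem_range.1 hi), ← Finset.sum_sub_distrib]
  congr 1
  exact Finset.sum_congr rfl fun i hi => by simp [hh', Finset.mem_range.1 hi, he]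

end VarianceGrowth

/-! ### Etemadi's argument from a variance bound -/

section StrongLaw

open Finset

variable {Ω : Type*} [MeasureSpace Ω] [IsProbabilityMeasure (ℙ : Measure Ω)]

lemma integral_sq_truncation_mono {Y : Ω → ℝ} (hY : AEStronglyMeasurable Y ℙ)
    (hnonneg : ∀ ω, 0 ≤ Y ω) {A B : ℝ} (hAB : A ≤ B) :
    𝔼[truncation Y A ^ 2] ≤ 𝔼[truncation Y B ^ 2] := by
  refine integral_mono hY.memLp_truncation.integrable_sq hY.memLp_truncation.integrable_sq
    fun ω => ?_
  simp only [Pi.pow_apply]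
  refine pow_le_pow_left₀ (truncation_nonneg A (hnonneg ω)) ?_ 2
  rw [truncation_eq_of_nonneg hnonneg, truncation_eq_of_nonneg hnonneg]
  simp only [Function.comp_apply]
  by_cases h : Y ω ∈ Set.Ioc 0 A
  · rw [Set.indicator_of_mem h, Set.indicator_of_mem (Set.Ioc_subset_Ioc_right hAB h)]
  · rw [Set.indicator_of_notMem h]
    exact Set.indicator_nonneg (fun x hx => hx.1.le) _

variable (Y : ℕ → Ω → ℝ) (hint : Integrable (Y 0))
  (hident : ∀ i, IdentDistrib (Y i) (Y 0)) (hnonneg : ∀ i ω, 0 ≤ Y i ω) {K : ℝ} (hK : 0 ≤ K)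
  (hvar : ∀ n : ℕ, Var[∑ i ∈ range n, truncation (Y i) i] ≤
    K * n * 𝔼[truncation (Y 0) n ^ 2])

include hint hnonneg hK hvar in
/-- Along geometric subsequences, a linear variance bound for the truncated sums gives a summable
variance series. -/
lemma sum_variance_sum_truncation_le {c : ℝ} (c_one : 1 < c) (N : ℕ) :
    ∑ i ∈ range N, ((⌊c ^ i⌋₊ : ℝ) ^ 2)⁻¹ *
      Var[∑ j ∈ range ⌊c ^ i⌋₊, truncation (Y j) j] ≤
        K * (4 * (c ^ 5 * (c - 1)⁻¹ ^ 3) * (2 * 𝔼[Y 0])) := by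
  let u : ℕ → ℕ := fun n => ⌊c ^ n⌋₊
  let W : ℕ → ℝ := fun n => 𝔼[truncation (Y 0) n ^ 2]
  have u_mono : Monotone u := fun i j hij => Nat.floor_mono (pow_right_mono₀ c_one.le hij)
  have hW0 : ∀ n, 0 ≤ W n := fun n => integral_nonneg fun ω => sq_nonneg _
  -- The variance bound carries n·W n instead of the sum of W j over j < n available under
  -- independence. As W is nondecreasing, the terms n ≤ j < 2n recover a sum.
  have hW : ∀ n : ℕ, n * W n ≤ ∑ j ∈ range (2 * n), W j := fun n => by
    calc (n : ℝ) * W n = ∑ j ∈ Ico n (2 * n), W n := by simp [two_mul]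
      _ ≤ ∑ j ∈ Ico n (2 * n), W j := by
          refine sum_le_sum fun j hj => ?_
          exact integral_sq_truncation_mono hint.1 (hnonneg 0)
            (Nat.cast_le.2 (mem_Ico.1 hj).1)
      _ ≤ ∑ j ∈ range (2 * n), W j := by
          refine sum_le_sum_of_subset_of_nonneg ?_ fun j _ _ => hW0 j
          intro j hj
          exact mem_range.2 (mem_Ico.1 hj).2
  have hc0 : 0 ≤ c ^ 5 * (c - 1)⁻¹ ^ 3 := by
    have : 0 < c - 1 := sub_pos.2 c_one
    positivity
  calc
    ∑ i ∈ range N, ((u i : ℝ) ^ 2)⁻¹ * Var[∑ j ∈ range (u i), truncation (Y j) j] ≤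
        ∑ i ∈ range N, ((u i : ℝ) ^ 2)⁻¹ * (K * ∑ j ∈ range (2 * u i), W j) := by
      gcongr with i
      refine (hvar _).trans ?_
      rw [mul_assoc]
      gcongr
      exact hW _
    _ = K * ∑ i ∈ range N, ((u i : ℝ) ^ 2)⁻¹ * ∑ j ∈ range (2 * u i), W j := by
      rw [mul_sum]
      exact sum_congr rfl fun i _ => by ring
    _ = K * ∑ j ∈ range (2 * u (N - 1)),
        (∑ i ∈ range N with j < 2 * u i, ((u i : ℝ) ^ 2)⁻¹) * W j := by
      congr 1
      simp_rw [mul_sum, sum_mul, sum_sigma']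
      refine sum_nbij' (fun p ↦ ⟨p.2, p.1⟩) (fun p ↦ ⟨p.2, p.1⟩) ?_ ?_ ?_ ?_ ?_
      · simp only [mem_sigma, mem_range, mem_filter, and_imp, Sigma.forall]
        exact fun a b haN hb ↦ ⟨hb.trans_le <|
          Nat.mul_le_mul_left 2 <| u_mono <| Nat.le_pred_of_lt haN, haN, hb⟩
      all_goals simp
    _ ≤ K * ∑ j ∈ range (2 * u (N - 1)),
        4 * (c ^ 5 * (c - 1)⁻¹ ^ 3) * (((j : ℝ) ^ 2)⁻¹ * W j) := by
      gcongr ?_ * ∑ _ ∈ _, ?_ with j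
      rcases eq_zero_or_pos j with (rfl | hj)
      · simp [W]
      rw [← mul_assoc]
      refine mul_le_mul_of_nonneg_right ?_ (hW0 j)
      -- The doubled range turns the condition into j/2 < u i; this is the source of the factor 4.
      have hj' : (0 : ℝ) < (j : ℝ) / 2 := by positivity
      have := sum_div_nat_floor_pow_sq_le_div_sq N hj' c_one
      have hfil : ∀ i, ((j : ℝ) / 2 < (⌊c ^ i⌋₊ : ℝ)) ↔ j < 2 * u i := fun i => by
        rw [div_lt_iff₀ two_pos, mul_comm]
        exact_mod_cast Iff.rfl
      simp only [hfil, one_div] at this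
      refine this.trans_eq ?_
      field_simp
      norm_num
    _ = K * (4 * (c ^ 5 * (c - 1)⁻¹ ^ 3) *
        ∑ j ∈ range (2 * u (N - 1)), ((j : ℝ) ^ 2)⁻¹ * W j) := by rw [← mul_sum]
    _ ≤ K * (4 * (c ^ 5 * (c - 1)⁻¹ ^ 3) * (2 * 𝔼[Y 0])) := by
      gcongr
      exact sum_variance_truncation_le hint (hnonneg 0) _

include hint hident hnonneg hK hvar in
lemma ae_eventually_abs_sum_truncation_sub_lt {c : ℝ} (c_one : 1 < c) {ε : ℝ} (εpos : 0 < ε) :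
    ∀ᵐ ω, ∀ᶠ n : ℕ in atTop, |∑ i ∈ range ⌊c ^ n⌋₊, truncation (Y i) i ω -
      𝔼[∑ i ∈ range ⌊c ^ n⌋₊, truncation (Y i) i]| < ε * ⌊c ^ n⌋₊ := by
  let u : ℕ → ℕ := fun n => ⌊c ^ n⌋₊
  let S : ℕ → Ω → ℝ := fun n => ∑ i ∈ range n, truncation (Y i) i
  let C := K * (4 * (c ^ 5 * (c - 1)⁻¹ ^ 3) * (2 * 𝔼[Y 0]))
  have hprob : ∀ N, ∑ i ∈ range N, ℙ {ω | (u i * ε : ℝ) ≤ |S (u i) ω - 𝔼[S (u i)]|} ≤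
      ENNReal.ofReal (ε⁻¹ ^ 2 * C) := by
    intro N
    calc
      ∑ i ∈ range N, ℙ {ω | (u i * ε : ℝ) ≤ |S (u i) ω - 𝔼[S (u i)]|} ≤
          ∑ i ∈ range N, ENNReal.ofReal (Var[S (u i)] / (u i * ε) ^ 2) := by
        gcongr with i _
        apply meas_ge_le_variance_div_sq
        · exact memLp_finsetSum' _ fun j _ => (hident j).aestronglyMeasurable_fst.memLp_truncation
        · apply mul_pos (Nat.cast_pos.2 _) εpos
          refine zero_lt_one.trans_le ?_
          apply Nat.le_floor
          rw [Nat.cast_one]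
          apply one_le_pow₀ c_one.le
      _ = ENNReal.ofReal (∑ i ∈ range N, Var[S (u i)] / (u i * ε) ^ 2) := by
        rw [ENNReal.ofReal_sum_of_nonneg fun i _ => ?_]
        exact div_nonneg (variance_nonneg _ _) (sq_nonneg _)
      _ ≤ ENNReal.ofReal (ε⁻¹ ^ 2 * C) := by
        apply ENNReal.ofReal_le_ofReal
        simp_rw [div_eq_inv_mul, ← inv_pow, mul_inv, mul_comm _ (ε⁻¹), mul_pow, mul_assoc,
          ← mul_sum]
        gcongr
        simp only [inv_pow]
        exact sum_variance_sum_truncation_le Y hint hnonneg hK hvar c_one N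
  have htsum : (∑' i, ℙ {ω | (u i * ε : ℝ) ≤ |S (u i) ω - 𝔼[S (u i)]|}) < ⊤ :=
    (le_of_tendsto_of_tendsto' (ENNReal.tendsto_nat_tsum _) tendsto_const_nhds hprob).trans_lt
      ENNReal.ofReal_lt_top
  filter_upwards [ae_eventually_notMem htsum.ne] with ω hω
  filter_upwards [hω] with n hn
  have hn' := not_le.1 hn
  simp only [S, u, Finset.sum_apply] at hn'
  rw [mul_comm]
  simpa only [Finset.sum_apply] using hn'

include hint hident hnonneg hK hvar in
-- Three errors are o(n): the fluctuation of the truncated sums, the bias of their means, and the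
-- almost sure effect of truncation.
lemma ae_tendsto_sum_floor_pow_div {c : ℝ} (c_one : 1 < c) :
    ∀ᵐ ω, Tendsto (fun n : ℕ => (∑ i ∈ range ⌊c ^ n⌋₊, Y i ω) / ⌊c ^ n⌋₊) atTop
      (𝓝 𝔼[Y 0]) := by
  have hpos : ∀ n : ℕ, (0 : ℝ) < ⌊c ^ n⌋₊ := by
    intro n
    refine zero_lt_one.trans_le ?_
    simp only [Nat.one_le_cast, Nat.one_le_floor_iff, one_le_pow₀ c_one.le]
  have hA : Tendsto (fun n : ℕ => ⌊c ^ n⌋₊) atTop atTop :=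
    tendsto_nat_floor_atTop.comp (tendsto_pow_atTop_atTop_of_one_lt c_one)
  obtain ⟨v, -, v_pos, v_lim⟩ :
      ∃ v : ℕ → ℝ, StrictAnti v ∧ (∀ n : ℕ, 0 < v n) ∧ Tendsto v atTop (𝓝 0) :=
    exists_seq_strictAnti_tendsto (0 : ℝ)
  filter_upwards [ae_all_iff.2 fun i => ae_eventually_abs_sum_truncation_sub_lt Y hint hident
    hnonneg hK hvar c_one (v_pos i), strong_law_aux5 Y hint hident hnonneg] with ω hω h'ω
  have h1 : (fun n : ℕ => ∑ i ∈ range ⌊c ^ n⌋₊, truncation (Y i) i ω -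
      𝔼[∑ i ∈ range ⌊c ^ n⌋₊, truncation (Y i) i]) =o[atTop] fun n : ℕ => (⌊c ^ n⌋₊ : ℝ) := by
    refine Asymptotics.isLittleO_iff.2 fun ε εpos => ?_
    obtain ⟨i, hi⟩ : ∃ i, v i < ε := ((tendsto_order.1 v_lim).2 ε εpos).exists
    filter_upwards [hω i] with n hn
    simp only [Real.norm_eq_abs, Nat.abs_cast]
    exact hn.le.trans (mul_le_mul_of_nonneg_right hi.le (Nat.cast_nonneg _))
  have h2 := (strong_law_aux3 Y hint hident).comp_tendsto hA
  have h3 := h'ω.comp_tendsto hA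
  have hL : (fun n : ℕ => ∑ i ∈ range ⌊c ^ n⌋₊, Y i ω - ⌊c ^ n⌋₊ * 𝔼[Y 0]) =o[atTop]
      fun n => (⌊c ^ n⌋₊ : ℝ) := by
    refine ((h1.add h2).sub h3).congr_left fun n => ?_
    simp only [Function.comp_apply]
    ring
  rw [← tendsto_sub_nhds_zero_iff]
  refine hL.tendsto_div_nhds_zero.congr fun n => ?_
  rw [sub_div, mul_div_cancel_left₀ _ (hpos n).ne']

include hint hident hnonneg hK hvar in
/-- **Strong law of large numbers** for nonnegative identically distributed variables whose
truncated partial sums have linearly growing variances. -/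
lemma ae_tendsto_sum_div_of_variance_le :
    ∀ᵐ ω, Tendsto (fun n : ℕ => (∑ i ∈ range n, Y i ω) / n) atTop (𝓝 𝔼[Y 0]) := by
  obtain ⟨c, -, cone, clim⟩ :
      ∃ c : ℕ → ℝ, StrictAnti c ∧ (∀ n : ℕ, 1 < c n) ∧ Tendsto c atTop (𝓝 1) :=
    exists_seq_strictAnti_tendsto (1 : ℝ)
  filter_upwards [ae_all_iff.2 fun k =>
    ae_tendsto_sum_floor_pow_div Y hint hident hnonneg hK hvar (cone k)] with ω hω
  -- Nonnegativity makes the partial sums monotone, which fills the gaps between the ⌊cⁿ⌋ as c ↓ 1.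
  refine tendsto_div_of_monotone_of_tendsto_div_floor_pow _ _ ?_ c cone clim hω
  intro m n hmn
  exact sum_le_sum_of_subset_of_nonneg (range_mono hmn) fun i _ _ => hnonneg i ω

end StrongLaw

/-! ### Strong law for mixing sequences -/

section MixingStrongLaw

variable {Ω : Type*} {m0 : MeasurableSpace Ω} {μ : Measure Ω} [IsProbabilityMeasure μ]
  {X : ℕ → Ω → ℝ}

lemma ae_tendsto_sum_div_of_nonneg (hX : ∀ i, 1 ≤ i → Measurable (X i))
    (hid : ∀ i, 1 ≤ i → IdentDistrib (X i) (X 1) μ μ)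
    (hsum : Summable (fun n : ℕ => √(phiMix μ X (2 ^ (n + 1))))) {f : ℝ → ℝ}
    (hf : Measurable f) (hf0 : ∀ x, 0 ≤ f x) (hint : Integrable (fun ω => f (X 1 ω)) μ) :
    ∀ᵐ ω ∂μ, Tendsto (fun n : ℕ => (∑ i ∈ Finset.range n, f (X (i + 1) ω)) / n) atTop
      (𝓝 (∫ ω, f (X 1 ω) ∂μ)) := by
  obtain ⟨K, hK0, hK⟩ := exists_variance_sum_le hX hsum
  let mΩ : MeasureSpace Ω := ⟨μ⟩
  have hprob : IsProbabilityMeasure (ℙ : Measure Ω) := ‹IsProbabilityMeasure μ›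
  let Y : ℕ → Ω → ℝ := fun i ω => f (X (i + 1) ω)
  have hident : ∀ i, IdentDistrib (Y i) (Y 0) ℙ ℙ := fun i => (hid (i + 1) (by omega)).comp hf
  refine ae_tendsto_sum_div_of_variance_le Y hint hident (fun i ω => hf0 _) hK0 fun n => ?_
  have hV0 : 0 ≤ 𝔼[truncation (Y 0) n ^ 2] := integral_nonneg fun ω => sq_nonneg _
  -- The sup bound, here `n`, does not enter the constant; only the second moment at the largest
  -- truncation level does.
  refine hK (fun i x => Set.indicator (Set.Ioc (-(i : ℝ)) i) id (f x)) n n _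
    (fun i => (measurable_id.indicator measurableSet_Ioc).comp hf) (fun i hi x => ?_) hV0
    (fun i hi => ?_)
  · refine (abs_truncation_le_bound f i x).trans ?_
    rw [Nat.abs_cast]
    exact_mod_cast hi.le
  · have h1 : 𝔼[truncation (Y i) i ^ 2] = 𝔼[truncation (Y 0) i ^ 2] :=
      ((hident i).truncation (A := i)).pow.integral_eq
    exact h1.trans_le (integral_sq_truncation_mono hint.1 (fun ω => hf0 _)
      (Nat.cast_le.2 hi.le))

/-- **Strong law of large numbers** for instantaneous functions of a `φ`-mixing sequence. -/
lemma ae_tendsto_average_of_phiMixing (hX : ∀ i, 1 ≤ i → Measurable (X i))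
    (hid : ∀ i, 1 ≤ i → IdentDistrib (X i) (X 1) μ μ)
    (hsum : Summable (fun n : ℕ => √(phiMix μ X (2 ^ (n + 1))))) {f : ℝ → ℝ}
    (hf : Measurable f) (hint : Integrable (fun ω => f (X 1 ω)) μ) :
    ∀ᵐ ω ∂μ, Tendsto (fun n : ℕ => (1 / (n : ℝ)) * ∑ i ∈ Finset.Icc 1 n, f (X i ω)) atTop
      (𝓝 (∫ ω, f (X 1 ω) ∂μ)) := by
  have hpos := ae_tendsto_sum_div_of_nonneg hX hid hsum (f := fun x => max (f x) 0)
    (hf.max measurable_const) (fun x => le_max_right _ _) hint.pos_part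
  have hneg := ae_tendsto_sum_div_of_nonneg hX hid hsum (f := fun x => max (-f x) 0)
    (hf.neg.max measurable_const) (fun x => le_max_right _ _) hint.neg_part
  filter_upwards [hpos, hneg] with ω h1 h2
  have h3 := h1.sub h2
  rw [← integral_sub hint.pos_part hint.neg_part] at h3
  simp only [max_zero_sub_max_neg_zero_eq_self] at h3
  refine h3.congr fun n => ?_
  rw [← sub_div, ← Finset.sum_sub_distrib, one_div, div_eq_inv_mul]
  simp only [max_zero_sub_max_neg_zero_eq_self]
  congr 1
  rw [Finset.range_eq_Ico, Finset.sum_Ico_add' (fun i => f (X i ω)) 0 n 1]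
  rfl

end MixingStrongLaw

/-! ### Quantiles and uniform convergence of monotone functions -/

section GlivenkoCantelli

/-- The left-continuous `c`-quantile of a distribution on the line. -/
noncomputable def lowerQuantile (ν : Measure ℝ) (c : ℝ) : ℝ := sInf {x | c ≤ cdf ν x}

variable (ν : Measure ℝ)

lemma bddBelow_setOf_le_cdf {c : ℝ} (hc : 0 < c) : BddBelow {x | c ≤ cdf ν x} := by
  obtain ⟨b, hb⟩ := ((tendsto_cdf_atBot ν).eventually_lt_const hc).exists
  refine ⟨b, fun x hx => ?_⟩
  by_contra! hlt
  exact (hb.trans_le hx).not_ge (monotone_cdf ν hlt.le)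

lemma lowerQuantile_le {c x : ℝ} (hc : 0 < c) (hx : c ≤ cdf ν x) : lowerQuantile ν c ≤ x :=
  csInf_le (bddBelow_setOf_le_cdf ν hc) hx

/-- Right continuity of the distribution function. The witness `x` excludes the infimum of an empty
set. -/
lemma le_cdf_lowerQuantile {c x : ℝ} (hx : c ≤ cdf ν x) :
    c ≤ cdf ν (lowerQuantile ν c) := by
  have hr : Tendsto (cdf ν) (𝓝[>] (lowerQuantile ν c)) (𝓝 (cdf ν (lowerQuantile ν c))) :=
    ((cdf ν).right_continuous _).tendsto.mono_left (nhdsWithin_mono _ Set.Ioi_subset_Ici_self)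
  refine ge_of_tendsto hr ?_
  filter_upwards [self_mem_nhdsWithin] with y hy
  obtain ⟨z, hz, hzy⟩ := exists_lt_of_csInf_lt ⟨x, hx⟩ hy
  exact le_trans hz (monotone_cdf ν hzy.le)

variable [IsProbabilityMeasure ν]

lemma measureReal_Iio_lowerQuantile_le {c : ℝ} (hc : 0 < c) :
    ν.real (Set.Iio (lowerQuantile ν c)) ≤ c := by
  have hcdf : Function.leftLim (cdf ν) (lowerQuantile ν c) ≤ c := by
    refine le_of_tendsto ((monotone_cdf ν).tendsto_leftLim _) ?_
    filter_upwards [self_mem_nhdsWithin] with y hy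
    by_contra! hlt
    exact (not_le.2 hy) (lowerQuantile_le ν hc hlt.le)
  have := (cdf ν).measure_Iio (tendsto_cdf_atBot ν) (lowerQuantile ν c)
  rw [measure_cdf, sub_zero] at this
  rw [measureReal_def, this]
  exact ENNReal.toReal_le_of_le_ofReal hc.le (ENNReal.ofReal_le_ofReal hcdf)

/-- **Glivenko–Cantelli, deterministic part**: monotone functions with values in `[0, 1]` that
converge, together with their left versions, at all rational quantiles converge uniformly. -/
lemma tendsto_iSup_abs_sub_cdf {G H : ℕ → ℝ → ℝ} (hG0 : ∀ n x, 0 ≤ G n x)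
    (hG1 : ∀ n x, G n x ≤ 1) (hmono : ∀ n, Monotone (G n)) (hGH : ∀ n x y, x < y → G n x ≤ H n y)
    (hG : ∀ j m : ℕ, Tendsto (fun n => G n (lowerQuantile ν (j / m))) atTop
      (𝓝 (cdf ν (lowerQuantile ν (j / m)))))
    (hH : ∀ j m : ℕ, Tendsto (fun n => H n (lowerQuantile ν (j / m))) atTop
      (𝓝 (ν.real (Set.Iio (lowerQuantile ν (j / m)))))) :
    Tendsto (fun n => ⨆ x, |G n x - cdf ν x|) atTop (𝓝 0) := by
  rw [Metric.tendsto_atTop']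
  intro ε hε
  obtain ⟨m, hm⟩ := exists_nat_one_div_lt (show (0 : ℝ) < ε / 4 by positivity)
  set M : ℕ := m + 1 with hMdef
  have hM : (0 : ℝ) < M := by positivity
  have hMε : 1 / (M : ℝ) < ε / 4 := by simpa [hMdef] using hm
  have hev : ∀ᶠ n in atTop, ∀ j ∈ Finset.range (M + 1),
      dist (G n (lowerQuantile ν (j / M))) (cdf ν (lowerQuantile ν (j / M))) < ε / 4 ∧
      dist (H n (lowerQuantile ν (j / M))) (ν.real (Set.Iio (lowerQuantile ν (j / M)))) < ε / 4 := by
    rw [eventually_all_finset]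
    intro j _
    exact ((hG j M).eventually (Metric.ball_mem_nhds _ (by positivity))).and
      ((hH j M).eventually (Metric.ball_mem_nhds _ (by positivity)))
  obtain ⟨n₀, hn₀⟩ := eventually_atTop.1 hev
  refine ⟨n₀, fun n hn => ?_⟩
  have hn := hn₀ n hn.le
  have hbound : ∀ x, |G n x - cdf ν x| ≤ ε / 2 := by
    intro x
    have hF0 : 0 ≤ cdf ν x := cdf_nonneg ν x
    have hF1 : cdf ν x ≤ 1 := cdf_le_one ν x
    -- Then j/M ≤ F(x) < (j+1)/M, so x lies between the quantiles of these levels: `G` at the lower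
    -- one bounds G(x) below and `H` at the upper one bounds it above. Using `H` there avoids an
    -- error from atoms.
    set j : ℕ := ⌊M * cdf ν x⌋₊ with hj
    have hj1 : (j : ℝ) / M ≤ cdf ν x := by
      rw [div_le_iff₀ hM, mul_comm]
      exact Nat.floor_le (by positivity)
    have hj2 : cdf ν x < ((j + 1 : ℕ) : ℝ) / M := by
      rw [lt_div_iff₀ hM, mul_comm]
      push_cast
      exact Nat.lt_floor_add_one _
    have hj3 : ((j + 1 : ℕ) : ℝ) / M = j / M + 1 / M := by push_cast; ring
    have hjM : j ≤ M := by
      have : (j : ℝ) ≤ M := by rw [div_le_iff₀ hM] at hj1; nlinarith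
      exact_mod_cast this
    rw [abs_le]
    constructor
    · rcases Nat.eq_zero_or_pos j with h0 | h0
      · rw [h0] at hj3 hj2
        have := hG0 n x
        rw [hj3] at hj2
        simp only [Nat.cast_zero, zero_div, zero_add] at hj2
        linarith
      · have hc : (0 : ℝ) < j / M := by positivity
        have h1 := hmono n (lowerQuantile_le ν hc hj1)
        have h2 := le_cdf_lowerQuantile ν hj1
        have h3 := (hn j (Finset.mem_range.2 (by omega))).1
        rw [Real.dist_eq, abs_lt] at h3
        linarith [h3.1]
    -- Level 1 need not be attained, so its quantile may be meaningless; there G ≤ 1 suffices.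
    · rcases lt_or_ge (j + 1) M with hlt | hge
      · have hc : (0 : ℝ) < ((j + 1 : ℕ) : ℝ) / M := by positivity
        have hc1 : ((j + 1 : ℕ) : ℝ) / M < 1 := by
          rw [div_lt_one hM]
          exact_mod_cast hlt
        obtain ⟨z, hz⟩ := ((tendsto_cdf_atTop ν).eventually_const_lt hc1).exists
        have hxq : x < lowerQuantile ν (((j + 1 : ℕ) : ℝ) / M) := by
          by_contra! hle
          exact (hj2.trans_le ((le_cdf_lowerQuantile ν hz.le).trans
            (monotone_cdf ν hle))).false
        have h1 := hGH n _ _ hxq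
        have h2 := measureReal_Iio_lowerQuantile_le ν hc
        have h3 := (hn (j + 1) (Finset.mem_range.2 (by omega))).2
        rw [Real.dist_eq, abs_lt] at h3
        linarith [h3.2]
      · have h1 : (1 : ℝ) ≤ ((j + 1 : ℕ) : ℝ) / M := by
          rw [one_le_div hM]
          exact_mod_cast hge
        linarith [hG1 n x]
  rw [Real.dist_eq, sub_zero, abs_of_nonneg (Real.iSup_nonneg fun x => abs_nonneg _)]
  exact (ciSup_le hbound).trans_lt (by linarith)

end GlivenkoCantelli

/-! ### Empirical frequencies and the main theorem -/

section EmpiricalCDF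

variable {Ω : Type*} {m0 : MeasurableSpace Ω} {μ : Measure Ω} [IsProbabilityMeasure μ]
  {X : ℕ → Ω → ℝ}

lemma ae_tendsto_card_filter_div (hX : ∀ i, 1 ≤ i → Measurable (X i))
    (hid : ∀ i, 1 ≤ i → IdentDistrib (X i) (X 1) μ μ)
    (hsum : Summable (fun n : ℕ => √(phiMix μ X (2 ^ (n + 1))))) {s : Set ℝ}
    [DecidablePred (· ∈ s)] (hs : MeasurableSet s) :
    ∀ᵐ ω ∂μ, Tendsto (fun n : ℕ => ((Finset.Icc 1 n).filter (fun i => X i ω ∈ s)).card / (n : ℝ))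
      atTop (𝓝 ((μ.map (X 1)).real s)) := by
  have hX1 := hX 1 le_rfl
  have hcomp : (fun ω => s.indicator (1 : ℝ → ℝ) (X 1 ω)) = (X 1 ⁻¹' s).indicator 1 := rfl
  have hint : Integrable (fun ω => s.indicator (1 : ℝ → ℝ) (X 1 ω)) μ := by
    rw [hcomp]
    exact (integrable_const (1 : ℝ)).indicator (hX1 hs)
  have hval : ∫ ω, s.indicator (1 : ℝ → ℝ) (X 1 ω) ∂μ = (μ.map (X 1)).real s := by
    rw [hcomp, integral_indicator_one (hX1 hs), map_measureReal_apply hX1 hs]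
  filter_upwards [ae_tendsto_average_of_phiMixing hX hid hsum
    (measurable_one.indicator hs) hint] with ω hω
  rw [hval] at hω
  refine hω.congr fun n => ?_
  rw [one_div, div_eq_inv_mul, Finset.card_filter]
  push_cast
  simp only [Set.indicator_apply, Pi.one_apply]

end EmpiricalCDF

theorem lemma1 {Ω : Type*} [MeasurableSpace Ω] (μ : Measure Ω) [IsProbabilityMeasure μ]
    (X : ℕ → Ω → ℝ) (hX : ∀ i, 1 ≤ i → Measurable (X i))
    (hid : ∀ i, 1 ≤ i → IdentDistrib (X i) (X 1) μ μ)
    (hmix : IsPhiMixing μ X)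
    (hsum : Summable (fun n : ℕ => Real.sqrt (phiMix μ X (2 ^ (n + 1))))) :
    (∀ f : ℝ → ℝ, Measurable f → Integrable (fun ω => f (X 1 ω)) μ →
      ∀ᵐ ω ∂μ, Tendsto (fun n : ℕ => (1 / (n : ℝ)) * ∑ i ∈ Finset.Icc 1 n, f (X i ω))
        atTop (𝓝 (∫ ω', f (X 1 ω') ∂μ))) ∧
    (∀ᵐ ω ∂μ, Tendsto
      (fun n : ℕ => ⨆ x : ℝ, |empiricalCDF X n ω x - cdf (μ.map (X 1)) x|)
        atTop (𝓝 0)) := by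
  refine ⟨fun f hf hint => ae_tendsto_average_of_phiMixing hX hid hsum hf hint, ?_⟩
  have hν : IsProbabilityMeasure (μ.map (X 1)) :=
    Measure.isProbabilityMeasure_map (hX 1 le_rfl).aemeasurable
  set ν := μ.map (X 1)
  classical
  -- Only countably many quantiles occur, so one null set serves all closed and open half-lines.
  filter_upwards [
    ae_all_iff.2 fun j : ℕ => ae_all_iff.2 fun m : ℕ => ae_tendsto_card_filter_div hX hid hsum
      (measurableSet_Iic (a := lowerQuantile ν (j / m))),
    ae_all_iff.2 fun j : ℕ => ae_all_iff.2 fun m : ℕ => ae_tendsto_card_filter_div hX hid hsum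
      (measurableSet_Iio (a := lowerQuantile ν (j / m)))] with ω h1 h2
  refine tendsto_iSup_abs_sub_cdf ν (G := fun n x => empiricalCDF X n ω x)
    (H := fun n x => ((Finset.Icc 1 n).filter (fun i => X i ω ∈ Set.Iio x)).card / (n : ℝ))
    (fun n x => by unfold empiricalCDF; positivity) (fun n x => ?_) (fun n x y hxy => ?_)
    (fun n x y hxy => ?_) (fun j m => ?_) h2
  · refine div_le_one_of_le₀ ?_ (Nat.cast_nonneg n)
    exact_mod_cast (Finset.card_filter_le _ _).trans (by simp)
  · simp only [empiricalCDF]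
    gcongr
  · simp only [empiricalCDF, Set.mem_Iio]
    gcongr
  · rw [cdf_eq_real]
    exact h1 j m
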